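/- **Setting.** A game has $n\ge 1$ senders, finite sets $\Theta$ (states), $S$ (signals) and $\mathcal A\neq\emptyset$ (actions), a prior $p\in\Delta(\Theta)$, payoffs $u_R,u_S:\mathcal A\times\Theta\to[0,1]$ of the receiver and of every sender, a set $\Phi$ of deviation functions $\varphi:S\to S$, and a signaling scheme $\psi:\Theta\to\Delta(S)$; write $\psi(\mathbf s|\theta)=\prod_j\psi(s_j|\theta)$ for $\mathbf s\in S^n$. A mechanism $x$ assigns to every $\mathbf s\in S^n$ a distribution $x[\mathbf s,\cdot]\in\Delta(\mathcal A)$; it is symmetric if $x[\mathbf s,\cdot]$ depends only on how often each signal occurs in $\mathbf s$. For $m\in\{R,S\}$ let $U_m(x)=\sum_{\mathbf s,a}x[\mathbf s,a]\sum_\theta p(\theta)u_m(a,\theta)\psi(\mathbf s|\theta)$, and let $U_i^\varphi(x)=\sum_{\mathbf s,a}x[(\varphi(s_i),\mathbf s_{-i}),a]\sum_\theta p(\theta)u_S(a,\theta)\psi(\mathbf s|\theta)$. The mechanism $x$ is IC if $U_i^\varphi(x)\le U_S(x)$ for all senders $i$ and all $\varphi\in\Phi$; an optimal IC mechanism $x^\star$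 maximizes $U_R$ over the IC mechanisms. In each round $t=1,\dots,T$ the receiver selects a symmetric mechanism $\xi^t$; then $\theta^t\sim p$, the signals $s^t_i\sim\psi(\cdot|\theta^t)$ are drawn independently and reported truthfully, and $a^t\sim\xi^t[\mathbf s^t,\cdot]$ is played. An online algorithm (possibly randomized) is given $T$ and all the parameters of the game except $\psi$, and it selects $\xi^t$ from its private randomness and the observations $(\theta^\tau,\mathbf s^\tau,a^\tau)_{\tau<t}$ (full feedback, which includes the realized payoffs; algorithms that know or observe less are special cases). The regret is $R^T=\sum_{t=1}^T\bigl(U_R(x^\star)-U_R(\xi^t)\bigr)$. **Theorem.** There is a constant $\delta>0$ such that no online algorithm has the following guarantee: for every game there is a function $f:\mathbb N\to\mathbb R$ with $f(T)=o(T)$ (which may depend on the game) such that, for every $T\ge 1$, with probability at least $1-\delta$ all of the mechanisms $\xi^1,\dots,\xi^T$ are IC and $R^T\le f(T)$. This remains true if the guarantee is only required on the games with ex-ante deviations ($\Phi$ is the set of all constant maps $S\to S$), and also if it is only required on the games with ex-interim deviations ($\Phi$ is the set of all maps $S\to S$). -/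

import Mathlib

open MeasureTheory

universe u

noncomputable section

namespace InfoAcquisition

/-- Everything about the game except the signaling scheme: `n ≥ 1` senders, finite sets of states,
signals and (at least one) actions, the prior `p ∈ Δ(Θ)`, the payoff of the receiver and the common
payoff of the senders, both with values in `[0, 1]`, and the set `Φ` of deviation functions. -/
structure GameForm where
  numSenders : ℕ
  numStates : ℕ
  numSignals : ℕ
  numActions : ℕ
  numSenders_pos : 0 < numSenders
  numActions_pos : 0 < numActions
  prior : stdSimplex ℝ (Fin numStates)
  uR : Fin numActions → Fin numStates → ℝ
  uS : Fin numActions → Fin numStates → ℝ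
  uR_mem : ∀ a θ, uR a θ ∈ Set.Icc (0 : ℝ) 1
  uS_mem : ∀ a θ, uS a θ ∈ Set.Icc (0 : ℝ) 1
  deviations : Set (Fin numSignals → Fin numSignals)

namespace GameForm

variable (K : GameForm)

abbrev Sender : Type := Fin K.numSenders
abbrev State : Type := Fin K.numStates
abbrev Signal : Type := Fin K.numSignals
abbrev Action : Type := Fin K.numActions

/-- Signal profiles `𝐬 ∈ 𝒮 = S^n`. -/
abbrev Profile : Type := K.Sender → K.Signal

/-- Signaling schemes `ψ : Θ → Δ(S)` (shared by all senders). -/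
abbrev Scheme : Type := K.State → stdSimplex ℝ K.Signal

/-- Mechanisms `x ∈ 𝒳`: a distribution over actions for every signal profile. -/
abbrev Mechanism : Type := K.Profile → stdSimplex ℝ K.Action

/-- Two profiles are symmetric if every signal occurs equally often in both. -/
instance symmetricProfiles : Setoid K.Profile where
  r s s' := ∀ σ : K.Signal, (Finset.univ.filter fun i => s i = σ).card
    = (Finset.univ.filter fun i => s' i = σ).card
  iseqv := ⟨fun _ _ => rfl, fun h σ => (h σ).symm, fun h h' σ => (h σ).trans (h' σ)⟩

/-- The classes `c ∈ 𝒞` of symmetric signal profiles. -/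
abbrev SignalClass : Type := Quotient K.symmetricProfiles

/-- Symmetric mechanisms `ξ ∈ Ξ`: a distribution over actions for every class of profiles. -/
abbrev SymMechanism : Type := K.SignalClass → stdSimplex ℝ K.Action

variable {K}

/-- A symmetric mechanism as a mechanism: `x[𝐬, a] = ξ[c(𝐬), a]`. -/
def SymMechanism.toMechanism (ξ : K.SymMechanism) : K.Mechanism := fun s => ξ ⟦s⟧

/-- `ψ(𝐬 | θ) = ∏ j, ψ(s_j | θ)`. -/
def profileProb (ψ : K.Scheme) (θ : K.State) (s : K.Profile) : ℝ := ∏ j, (ψ θ).1 (s j)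

/-- `U_R(x)`: the receiver's expected utility when all senders are truthful. -/
def utilityR (ψ : K.Scheme) (x : K.Mechanism) : ℝ :=
  ∑ s : K.Profile, ∑ a : K.Action,
    (x s).1 a * ∑ θ : K.State, K.prior.1 θ * K.uR a θ * profileProb ψ θ s

/-- `U_i(x)`: a sender's expected utility when all senders are truthful (the same for all `i`). -/
def utilityS (ψ : K.Scheme) (x : K.Mechanism) : ℝ :=
  ∑ s : K.Profile, ∑ a : K.Action,
    (x s).1 a * ∑ θ : K.State, K.prior.1 θ * K.uS a θ * profileProb ψ θ s

/-- `U_i^φ(x)`: the expected utility of sender `i` when she reports `φ(s_i)` instead of `s_i` and the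
other senders are truthful. -/
def deviationUtility (ψ : K.Scheme) (x : K.Mechanism) (i : K.Sender) (φ : K.Signal → K.Signal) : ℝ :=
  ∑ s : K.Profile, ∑ a : K.Action,
    (x (Function.update s i (φ (s i)))).1 a *
      ∑ θ : K.State, K.prior.1 θ * K.uS a θ * profileProb ψ θ s

/-- Incentive compatible mechanisms. -/
def IsIC (ψ : K.Scheme) (x : K.Mechanism) : Prop :=
  ∀ i : K.Sender, ∀ φ ∈ K.deviations, deviationUtility ψ x i φ - utilityS ψ x ≤ 0

/-- Optimal IC mechanisms: the maximizers of the receiver's utility among the IC mechanisms. -/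
def IsOptimalIC (ψ : K.Scheme) (x : K.Mechanism) : Prop :=
  IsIC ψ x ∧ ∀ y : K.Mechanism, IsIC ψ y → utilityR ψ y ≤ utilityR ψ x

/-- An optimal IC mechanism exists in every game. -/
theorem exists_isOptimalIC (ψ : K.Scheme) : ∃ x : K.Mechanism, IsOptimalIC ψ x := by
  have hcoord : ∀ (s : K.Profile) (a : K.Action),
      Continuous fun x : K.Mechanism => (x s).1 a := fun s a =>
    (continuous_apply a).comp (continuous_subtype_val.comp (continuous_apply s))
  have hR : Continuous fun x : K.Mechanism => utilityR ψ x :=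
    continuous_finsetSum _ fun s _ => continuous_finsetSum _ fun a _ =>
      (hcoord s a).mul continuous_const
  have hS : Continuous fun x : K.Mechanism => utilityS ψ x :=
    continuous_finsetSum _ fun s _ => continuous_finsetSum _ fun a _ =>
      (hcoord s a).mul continuous_const
  have hD : ∀ i φ, Continuous fun x : K.Mechanism => deviationUtility ψ x i φ := fun i φ =>
    continuous_finsetSum _ fun s _ => continuous_finsetSum _ fun a _ =>
      (hcoord _ a).mul continuous_const
  have hclosed : IsClosed {x : K.Mechanism | IsIC ψ x} := by
    simp only [IsIC, Set.ofPred_forall]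
    exact isClosed_iInter fun i => isClosed_iInter fun φ => isClosed_iInter fun _ =>
      isClosed_le ((hD i φ).sub hS) continuous_const
  have hne : {x : K.Mechanism | IsIC ψ x}.Nonempty := by
    refine ⟨fun _ => ⟨Pi.single ⟨0, K.numActions_pos⟩ 1, single_mem_stdSimplex ℝ _⟩, ?_⟩
    intro i φ _
    simp [deviationUtility, utilityS]
  obtain ⟨x, hx, hmax⟩ := hclosed.isCompact.exists_isMaxOn hne hR.continuousOn
  exact ⟨x, hx, fun y hy => hmax hy⟩

variable (K)

/-- What is observed at the end of a round under full feedback: the state of nature, the (truthfully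
reported) signal profile and the action played. They determine the realized payoffs. -/
abbrev Round : Type := K.State × K.Profile × K.Action

/-- A randomized receiver strategy for `T` rounds: it draws a private seed and, in each round, chooses
a symmetric mechanism as a function of the seed and the observations from the previous rounds. -/
structure Policy (T : ℕ) where
  Seed : Type u
  [measurableSpaceSeed : MeasurableSpace Seed]
  seedLaw : Measure Seed
  [isProbabilityMeasure_seedLaw : IsProbabilityMeasure seedLaw]
  act : (t : Fin T) → (Fin t → K.Round) → Seed → K.SymMechanism
  measurable_act : ∀ (t : Fin T) (h : Fin t → K.Round), Measurable (act t h)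

attribute [instance] Policy.measurableSpaceSeed Policy.isProbabilityMeasure_seedLaw

variable {K} {T : ℕ}

/-- The first `t` entries of a sequence of length `T`. -/
def past {R : Type} (h : Fin T → R) (t : Fin T) : Fin t → R :=
  fun j => h (Fin.castLE t.isLt.le j)

namespace Policy

/-- The sample space: the seed and the realization of all the rounds. -/
abbrev Outcome (π : K.Policy T) : Type u := π.Seed × (Fin T → K.Round)

/-- The mechanism `ξ^t` selected in round `t`. -/
def mechanism (π : K.Policy T) (t : Fin T) (z : π.Outcome) : K.SymMechanism :=
  π.act t (past z.2 t) z.1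

/-- Conditional probability, given the seed, that the rounds unfold as `h`: in each round
`θ ∼ p`, then `s_i ∼ ψ(· | θ)` independently, and then `a ∼ ξ^t[c(𝐬), ·]`. -/
def pathProb (π : K.Policy T) (ψ : K.Scheme) (ω : π.Seed) (h : Fin T → K.Round) : ℝ :=
  ∏ t : Fin T, K.prior.1 (h t).1 * profileProb ψ (h t).1 (h t).2.1 *
    ((π.act t (past h t) ω).toMechanism (h t).2.1).1 (h t).2.2

/-- The law of the interaction when the senders' signaling scheme is `ψ`. -/
def law (π : K.Policy T) (ψ : K.Scheme) : Measure π.Outcome :=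
  ∑ h : Fin T → K.Round,
    (π.seedLaw.withDensity fun ω => ENNReal.ofReal (π.pathProb ψ ω h)).map fun ω => (ω, h)

/-- The cumulative regret `R^T` with respect to the mechanism `xStar`. -/
def regret (π : K.Policy T) (ψ : K.Scheme) (xStar : K.Mechanism) (z : π.Outcome) : ℝ :=
  ∑ t : Fin T, (utilityR ψ xStar - utilityR ψ (π.mechanism t z).toMechanism)

end Policy

/-- Ex-ante deviations: the constant maps `S → S`. -/
def exAnte (S : Type) : Set (S → S) := {φ | ∀ s s', φ s = φ s'}

/-- Ex-interim deviations: all maps `S → S`. -/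
def exInterim (S : Type) : Set (S → S) := Set.univ

end GameForm

/-- An online algorithm (with full feedback): given the game form and the horizon, but not the
signaling scheme, it provides a receiver strategy. -/
def OnlineAlgorithm : Type (u + 1) := (K : GameForm) → (T : ℕ) → GameForm.Policy.{u} K T

/-- On every game with form in `𝒢` (and any signaling scheme), for some `f = o(T)` and for every
horizon `T ≥ 1`, with probability at least `1 - δ` all the mechanisms `ξ^1, …, ξ^T` are IC and
`R^T ≤ f T`. The rate `f` may depend on the game. -/
def OnlineAlgorithm.Guarantees (alg : OnlineAlgorithm.{u}) (δ : ℝ) (𝒢 : Set GameForm) : Prop :=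
  ∀ K ∈ 𝒢, ∀ ψ : K.Scheme, ∀ xStar : K.Mechanism, GameForm.IsOptimalIC ψ xStar →
    ∃ f : ℕ → ℝ, f =o[Filter.atTop] (fun T : ℕ => (T : ℝ)) ∧
      ∀ T : ℕ, 1 ≤ T →
        ENNReal.ofReal (1 - δ) ≤ (alg K T).law ψ
          {z | (∀ t : Fin T, GameForm.IsIC ψ ((alg K T).mechanism t z).toMechanism) ∧
            (alg K T).regret ψ xStar z ≤ f T}

end InfoAcquisition

end

namespace InfoAcquisition

open Finset

namespace GameForm

/-! Two-point argument on `hardForm` with the schemes `hardScheme D 0` and `hardScheme D ε`. Without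
noise every mechanism is IC and the optimum is worth at least 1. With any noise `ε > 0`, IC forces
action `1` to be at least as likely after signal `0` as after signal `1` (`signalProb_le_of_isIC`),
and a mechanism of this kind is worth at most 2/3 in the noiseless game
(`utilityR_le_of_signalProb_le`).

Let `E` be the event that all selected mechanisms satisfy this inequality. Safety in the noisy game
makes `E` likely there; sublinear regret in the noiseless game makes `Eᶜ` likely there, as `E` costs
regret at least `T / 3`. But noise `ε = 1 / (2T)` is almost invisible in `T` rounds: the noisy law
is at least `(1 - ε) ^ T ≥ 1/2` times the noiseless one (`Policy.ofReal_pow_mul_law_le`). Hence `E`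
and `Eᶜ` have total noisy probability at least 3/4 + 3/8 > 1. -/

/-! ### The law of the interaction and a change of measure -/

theorem profileProb_nonneg {K : GameForm} (ψ : K.Scheme) (θ : K.State) (s : K.Profile) :
    0 ≤ profileProb ψ θ s :=
  prod_nonneg fun j _ => (ψ θ).2.1 (s j)

theorem sum_profileProb {K : GameForm} (ψ : K.Scheme) (θ : K.State) :
    ∑ s, profileProb ψ θ s = 1 := by
  have h := (prod_univ_sum (fun _ : K.Sender => (univ : Finset K.Signal))
    (fun _ σ => (ψ θ).1 σ)).symm
  rw [Fintype.piFinset_univ] at h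
  refine h.trans ?_
  exact prod_eq_one fun _ _ => (ψ θ).2.2

/-- The probability of a sequence generated by history-dependent kernels sums to one. -/
theorem sum_prod_past {R : Type} [Fintype R] {T : ℕ} (g : (t : Fin T) → (Fin t → R) → R → ℝ)
    (hg : ∀ t h, ∑ r, g t h r = 1) :
    ∑ h : Fin T → R, ∏ t, g t (past h t) (h t) = 1 := by
  induction T with
  | zero => simp
  | succ T ih =>
    -- The last round is split off: no earlier factor depends on it, so it is summed first and
    -- contributes 1.
    rw [← (Fin.snocEquiv fun _ : Fin (T + 1) => R).sum_comp, Fintype.sum_prod_type_right]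
    rw [← ih (fun t => g t.castSucc) fun t => hg t.castSucc]
    refine sum_congr rfl fun h _ => ?_
    have key : ∀ r : R, ∏ t : Fin (T + 1),
        g t (past (Fin.snocEquiv (fun _ : Fin (T + 1) => R) (r, h)) t)
          (Fin.snocEquiv (fun _ : Fin (T + 1) => R) (r, h) t)
        = (∏ t : Fin T, g t.castSucc (past h t) (h t)) * g (Fin.last T) h r := by
      intro r
      rw [Fin.prod_univ_castSucc]
      have hp : ∀ t : Fin T,
          past (Fin.snocEquiv (fun _ : Fin (T + 1) => R) (r, h)) t.castSucc = past h t := by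
        intro t
        funext j
        exact Fin.snoc_castSucc (α := fun _ => R) r h (Fin.castLE t.isLt.le j)
      have hl : past (Fin.snocEquiv (fun _ : Fin (T + 1) => R) (r, h)) (Fin.last T) = h := by
        funext j
        exact Fin.snoc_castSucc (α := fun _ => R) r h j
      rw [hl]
      congr 1
      · refine prod_congr rfl fun t _ => ?_
        rw [hp]
        simp [Fin.snocEquiv]
      · simp [Fin.snocEquiv]
    rw [sum_congr rfl fun r _ => key r, ← mul_sum, hg, mul_one]

namespace Policy

variable {K : GameForm} {T : ℕ} (π : K.Policy T)

theorem pathProb_nonneg (ψ : K.Scheme) (ω : π.Seed) (h : Fin T → K.Round) :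
    0 ≤ π.pathProb ψ ω h :=
  prod_nonneg fun _ _ => mul_nonneg (mul_nonneg (K.prior.2.1 _) (profileProb_nonneg _ _ _))
    ((SymMechanism.toMechanism _ _).2.1 _)

theorem sum_pathProb (ψ : K.Scheme) (ω : π.Seed) :
    ∑ h : Fin T → K.Round, π.pathProb ψ ω h = 1 := by
  refine sum_prod_past (fun t h r => K.prior.1 r.1 * profileProb ψ r.1 r.2.1 *
    ((π.act t h ω).toMechanism r.2.1).1 r.2.2) fun t h => ?_
  simp only [Fintype.sum_prod_type, ← mul_sum]
  have h1 : ∀ s : K.Profile, ∑ a, ((π.act t h ω).toMechanism s).1 a = 1 := fun s =>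
    ((π.act t h ω).toMechanism s).2.2
  simp only [h1, mul_one, ← mul_sum, sum_profileProb]
  exact K.prior.2.2

theorem measurable_toMechanism_apply (s : K.Profile) (a : K.Action) :
    Measurable fun ξ : K.SymMechanism => (ξ.toMechanism s).1 a :=
  (measurable_pi_apply a).comp (measurable_subtype_coe.comp (measurable_pi_apply ⟦s⟧))

theorem measurable_pathProb (ψ : K.Scheme) (h : Fin T → K.Round) :
    Measurable fun ω => π.pathProb ψ ω h :=
  Finset.measurable_fun_prod _ fun t _ => measurable_const.mul
    ((measurable_toMechanism_apply _ _).comp (π.measurable_act t _))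

theorem measurable_mechanism (t : Fin T) : Measurable (π.mechanism t) :=
  measurable_from_prod_countable_left fun h => π.measurable_act t (past h t)

theorem law_apply (ψ : K.Scheme) {E : Set π.Outcome} (hE : MeasurableSet E) :
    π.law ψ E = ∑ h : Fin T → K.Round,
      ∫⁻ ω in {ω | (ω, h) ∈ E}, ENNReal.ofReal (π.pathProb ψ ω h) ∂π.seedLaw := by
  rw [law, Measure.finsetSum_apply]
  refine sum_congr rfl fun h _ => ?_
  have hm : Measurable fun ω : π.Seed => (ω, h) := measurable_prodMk_right
  rw [Measure.map_apply hm hE, withDensity_apply _ (hm hE)]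
  rfl

theorem law_univ (ψ : K.Scheme) : π.law ψ Set.univ = 1 := by
  rw [law_apply _ _ MeasurableSet.univ]
  simp only [Set.mem_univ, Set.ofPred_true, Measure.restrict_univ]
  rw [← lintegral_finsetSum _ fun h _ => (π.measurable_pathProb ψ h).ennreal_ofReal]
  have h1 : ∀ ω, ∑ h : Fin T → K.Round, ENNReal.ofReal (π.pathProb ψ ω h) = 1 := fun ω => by
    rw [← ENNReal.ofReal_sum_of_nonneg fun h _ => π.pathProb_nonneg ψ ω h, sum_pathProb,
      ENNReal.ofReal_one]
  simp [h1]

/-- If the profile probabilities under `ψ'` are at least `c` times those under `ψ`, then the law of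
the interaction over `T` rounds under `ψ'` is at least `c ^ T` times the law under `ψ`. -/
theorem ofReal_pow_mul_law_le {ψ ψ' : K.Scheme} {c : ℝ} (hc : 0 ≤ c)
    (hψ : ∀ θ s, c * profileProb ψ θ s ≤ profileProb ψ' θ s) {E : Set π.Outcome}
    (hE : MeasurableSet E) : ENNReal.ofReal (c ^ T) * π.law ψ E ≤ π.law ψ' E := by
  rw [law_apply _ _ hE, law_apply _ _ hE, mul_sum]
  refine sum_le_sum fun h _ => ?_
  rw [← lintegral_const_mul _ (π.measurable_pathProb ψ h).ennreal_ofReal]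
  refine lintegral_mono fun ω => ?_
  rw [← ENNReal.ofReal_mul (pow_nonneg hc T)]
  refine ENNReal.ofReal_le_ofReal ?_
  have hT : c ^ T = ∏ _t : Fin T, c := by simp
  rw [pathProb, pathProb, hT, ← prod_mul_distrib]
  refine prod_le_prod (fun t _ => mul_nonneg hc (mul_nonneg (mul_nonneg (K.prior.2.1 _)
    (profileProb_nonneg _ _ _)) ((SymMechanism.toMechanism _ _).2.1 _))) fun t _ => ?_
  -- The prior and the action probabilities do not involve the scheme, so each round loses only the
  -- factor `c` from the signals.
  rw [← mul_assoc]
  refine mul_le_mul_of_nonneg_right ?_ ((SymMechanism.toMechanism _ _).2.1 _)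
  rw [mul_left_comm]
  exact mul_le_mul_of_nonneg_left (hψ _ _) (K.prior.2.1 _)

end Policy

/-! ### The hard family of games -/

/-- One sender, three equally likely states, two signals and two actions. The receiver wants action
`1` in the states `0, 1` and action `0` in state `2`; the sender wants action `1` in state `0`,
action `0` in state `1`, and is indifferent in state `2`. -/
noncomputable def hardForm (D : Set (Fin 2 → Fin 2)) : GameForm where
  numSenders := 1
  numStates := 3
  numSignals := 2
  numActions := 2
  numSenders_pos := one_pos
  numActions_pos := two_pos
  prior := ⟨fun _ => 1 / 3, fun _ => by norm_num, by simp⟩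
  uR := ![![0, 0, 1], ![1, 1, 0]]
  uS := ![![0, 1, 0], ![1, 0, 0]]
  uR_mem a θ := by fin_cases a <;> fin_cases θ <;> simp
  uS_mem a θ := by fin_cases a <;> fin_cases θ <;> simp
  deviations := D

/-- The states `0, 1` are signaled by `1` and state `2` by `0`, except that in state `0` the signal is
`0` with probability `ε`. -/
noncomputable def hardScheme (D : Set (Fin 2 → Fin 2)) (ε : Set.Icc (0 : ℝ) 1) : (hardForm D).Scheme :=
  fun θ => ⟨(![![ε, 1 - ε], ![0, 1], ![1, 0]] : Fin 3 → Fin 2 → ℝ) θ, by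
    have h := ε.2.1
    have h' := ε.2.2
    change Fin 3 at θ
    refine ⟨fun s => ?_, ?_⟩
    · change Fin 2 at s
      fin_cases θ <;> fin_cases s <;> simp [h, h']
    · change ∑ s : Fin 2, _ = _
      fin_cases θ <;> simp [Fin.sum_univ_two]⟩

section hardForm

variable {D : Set (Fin 2 → Fin 2)}

/-- The probability of action `a` after signal `s`. -/
noncomputable def signalProb (x : (hardForm D).Mechanism) (s a : Fin 2) : ℝ :=
  (x fun _ => s).1 a

theorem signalProb_nonneg (x : (hardForm D).Mechanism) (s a : Fin 2) : 0 ≤ signalProb x s a :=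
  (x fun _ => s).2.1 a

theorem signalProb_add (x : (hardForm D).Mechanism) (s : Fin 2) :
    signalProb x s 0 + signalProb x s 1 = 1 := by
  have h := (x fun _ => s).2.2
  exact (Fin.sum_univ_two (signalProb x s)).symm.trans h

theorem sum_profile (F : (hardForm D).Profile → ℝ) :
    ∑ s, F s = F (fun _ => (0 : Fin 2)) + F fun _ => (1 : Fin 2) :=
  ((Equiv.funUnique (Fin 1) (Fin 2)).symm.sum_comp F).symm.trans (Fin.sum_univ_two _)

theorem profileProb_const (ψ : (hardForm D).Scheme) (θ : Fin 3) (s : Fin 2) :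
    profileProb ψ θ (fun _ => s) = (ψ θ).1 s :=
  Fin.prod_univ_one _

theorem utilityR_hardScheme (ε : Set.Icc (0 : ℝ) 1) (x : (hardForm D).Mechanism) :
    utilityR (hardScheme D ε) x =
      (signalProb x 0 0 + ε * signalProb x 0 1 + (2 - ε) * signalProb x 1 1) / 3 := by
  rw [utilityR, sum_profile]
  change ∑ a : Fin 2, signalProb x 0 a * ∑ θ : Fin 3, _ +
    ∑ a : Fin 2, signalProb x 1 a * ∑ θ : Fin 3, _ = _
  simp only [Fin.sum_univ_two, Fin.sum_univ_three, profileProb_const]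
  simp [hardForm, hardScheme]
  ring

theorem utilityS_hardScheme (ε : Set.Icc (0 : ℝ) 1) (x : (hardForm D).Mechanism) :
    utilityS (hardScheme D ε) x =
      (ε * signalProb x 0 1 + signalProb x 1 0 + (1 - ε) * signalProb x 1 1) / 3 := by
  rw [utilityS, sum_profile]
  change ∑ a : Fin 2, signalProb x 0 a * ∑ θ : Fin 3, _ +
    ∑ a : Fin 2, signalProb x 1 a * ∑ θ : Fin 3, _ = _
  simp only [Fin.sum_univ_two, Fin.sum_univ_three, profileProb_const]
  simp [hardForm, hardScheme]
  ring

theorem deviationUtility_hardScheme (ε : Set.Icc (0 : ℝ) 1) (x : (hardForm D).Mechanism)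
    (i : (hardForm D).Sender) (φ : (hardForm D).Signal → (hardForm D).Signal) :
    deviationUtility (hardScheme D ε) x i φ =
      (ε * signalProb x (φ (0 : Fin 2)) 1 + signalProb x (φ (1 : Fin 2)) 0 +
        (1 - ε) * signalProb x (φ (1 : Fin 2)) 1) / 3 := by
  -- With a single sender, her deviation replaces the whole profile.
  have hu : ∀ s : (hardForm D).Profile,
      Function.update s i (φ (s i)) = fun _ => φ (s (0 : Fin 1)) := by
    intro s
    funext j
    obtain rfl : j = i := Subsingleton.elim (α := Fin 1) j i
    rw [Function.update_self]
    exact congrArg (fun k => φ (s k)) (Subsingleton.elim (α := Fin 1) j 0)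
  simp only [deviationUtility, hu]
  refine (sum_profile _).trans ?_
  change ∑ a : Fin 2, signalProb x (φ (0 : Fin 2)) a * ∑ θ : Fin 3, _ +
    ∑ a : Fin 2, signalProb x (φ (1 : Fin 2)) a * ∑ θ : Fin 3, _ = _
  simp only [Fin.sum_univ_two, Fin.sum_univ_three, profileProb_const]
  simp [hardForm, hardScheme]
  ring

/-- Signal `0` then reveals state `2`, where the sender is indifferent, and signal `1` pools two
states whose preferences cancel. So her utility is 1/3 whatever she reports. -/
theorem isIC_hardScheme_zero (x : (hardForm D).Mechanism) : IsIC (hardScheme D 0) x := by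
  intro i φ _
  rw [deviationUtility_hardScheme, utilityS_hardScheme]
  have h := signalProb_add x (φ (1 : Fin 2))
  have h' := signalProb_add x 1
  simp only [Set.Icc.coe_zero]
  linarith

/-- Always reporting `0` earns exactly 1/3, while truthfulness earns 1/3 plus `ε / 3` times the
difference of the two sides. This constraint does not weaken as `ε` tends to 0. -/
theorem signalProb_le_of_isIC (hD : (fun _ => 0) ∈ D) {ε : Set.Icc (0 : ℝ) 1} (hε : 0 < (ε : ℝ))
    {x : (hardForm D).Mechanism} (hx : IsIC (hardScheme D ε) x) :
    signalProb x 1 1 ≤ signalProb x 0 1 := by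
  have h := ((deviationUtility_hardScheme ε x (0 : Fin 1) fun _ => (0 : Fin 2)).symm.le.trans
    (sub_nonpos.1 (hx _ _ hD))).trans (utilityS_hardScheme ε x).le
  have h0 := signalProb_add x 0
  have h1 := signalProb_add x 1
  refine le_of_mul_le_mul_left ?_ hε
  linarith

/-- The mechanism that plays the action with the name of the signal is optimal without noise. -/
theorem one_le_utilityR_of_isOptimalIC {x : (hardForm D).Mechanism}
    (hx : IsOptimalIC (hardScheme D 0) x) : 1 ≤ utilityR (hardScheme D 0) x := by
  let y : (hardForm D).Mechanism := fun s =>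
    ⟨Pi.single (s (0 : Fin 1)) 1, single_mem_stdSimplex ℝ _⟩
  refine le_trans (le_of_eq ?_) (hx.2 y (isIC_hardScheme_zero y))
  have h0 : signalProb y 0 0 = 1 := Pi.single_eq_same (M := fun _ : Fin 2 => ℝ) 0 1
  have h1 : signalProb y 1 1 = 1 := Pi.single_eq_same (M := fun _ : Fin 2 => ℝ) 1 1
  rw [utilityR_hardScheme, h0, h1]
  norm_num

theorem utilityR_le_of_signalProb_le {x : (hardForm D).Mechanism}
    (hx : signalProb x 1 1 ≤ signalProb x 0 1) : utilityR (hardScheme D 0) x ≤ 2 / 3 := by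
  rw [utilityR_hardScheme]
  have h0 := signalProb_add x 0
  have h1 := signalProb_add x 1
  have h2 := signalProb_nonneg x 1 0
  simp only [Set.Icc.coe_zero]
  linarith

/-- The domination holds in this direction only: signal `0` in state `0` is impossible without
noise, so for `ε > 0` no positive multiple of the noisy scheme lies below the noiseless one. -/
theorem mul_profileProb_hardScheme_le (ε : Set.Icc (0 : ℝ) 1) (θ : (hardForm D).State)
    (s : (hardForm D).Profile) :
    (1 - ε : ℝ) * profileProb (hardScheme D 0) θ s ≤ profileProb (hardScheme D ε) θ s := by
  have h := ε.2.1
  change Fin 3 at θ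
  obtain ⟨σ, rfl⟩ : ∃ σ : Fin 2, s = fun _ => σ :=
    ⟨s (0 : Fin 1), funext fun j => congrArg s (Subsingleton.elim (α := Fin 1) j 0)⟩
  rw [profileProb_const, profileProb_const]
  fin_cases θ <;> fin_cases σ <;> simp [hardScheme, h]

end hardForm

end GameForm

open GameForm

/-! ### The contradiction -/

theorem not_guarantees_of_hardForm_mem (alg : OnlineAlgorithm.{u}) {D : Set (Fin 2 → Fin 2)}
    (hD : (fun _ => 0) ∈ D) {𝒢 : Set GameForm} (h𝒢 : hardForm D ∈ 𝒢) :
    ¬ alg.Guarantees (1 / 4) 𝒢 := by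
  intro H
  obtain ⟨x, hx⟩ := exists_isOptimalIC (hardScheme D 0)
  obtain ⟨f, hf, hgood⟩ := H _ h𝒢 _ x hx
  -- The horizon is chosen from the noiseless rate alone, before `ε`; any constant below 1/3 would
  -- do in place of 1/6.
  obtain ⟨T, hfT, hT⟩ := ((hf.bound (by norm_num : (0 : ℝ) < 1 / 6)).and
    (Filter.eventually_ge_atTop 1)).exists
  have hT' : (1 : ℝ) ≤ T := by exact_mod_cast hT
  have hfT' : f T < T / 3 := by
    have h1 := (le_abs_self _).trans hfT
    rw [Real.norm_natCast] at h1
    linarith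
  have hε0 : (0 : ℝ) < 1 / (2 * T) := by positivity
  have hε1 : (1 : ℝ) / (2 * T) ≤ 1 / 2 :=
    one_div_le_one_div_of_le (by norm_num) (by linarith)
  let ε : Set.Icc (0 : ℝ) 1 := ⟨1 / (2 * T), hε0.le, by linarith⟩
  obtain ⟨y, hy⟩ := exists_isOptimalIC (hardScheme D ε)
  -- The noisy game depends on `T`, so its rate `g` is uncontrolled; only the IC half of its
  -- guarantee is used.
  obtain ⟨g, -, hgoodε⟩ := H _ h𝒢 _ y hy
  replace hgood := hgood T hT
  replace hgoodε := hgoodε T hT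
  set π := alg (hardForm D) T
  let E : Set π.Outcome := {z | ∀ t : Fin T,
    signalProb (π.mechanism t z).toMechanism 1 1 ≤ signalProb (π.mechanism t z).toMechanism 0 1}
  have hE : MeasurableSet E := by
    have hm : ∀ (t : Fin T) (s : Fin 2), Measurable fun z : π.Outcome =>
        signalProb (π.mechanism t z).toMechanism s 1 := fun t s =>
      (Policy.measurable_toMechanism_apply (K := hardForm D) (fun _ => s) (1 : Fin 2)).comp
        (π.measurable_mechanism t)
    exact measurableSet_setOfPred.2 <| Measurable.forall fun t =>
      measurableSet_setOfPred.1 (measurableSet_le (hm t 1) (hm t 0))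
  have h1 : ENNReal.ofReal (1 - 1 / 4) ≤ π.law (hardScheme D ε) E :=
    hgoodε.trans (measure_mono fun z hz t => signalProb_le_of_isIC hD hε0 (hz.1 t))
  have h2 : ENNReal.ofReal (1 - 1 / 4) ≤ π.law (hardScheme D 0) Eᶜ := by
    refine hgood.trans (measure_mono fun z hz hzE => ?_)
    have hreg : ∑ _t : Fin T, (1 / 3 : ℝ) ≤ π.regret (hardScheme D 0) x z :=
      sum_le_sum fun t _ => by
        have h3 := one_le_utilityR_of_isOptimalIC hx
        have h4 := utilityR_le_of_signalProb_le (hzE t)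
        linarith
    have h5 := hz.2
    rw [sum_const, card_univ, Fintype.card_fin, nsmul_eq_mul] at hreg
    linarith
  have hpow : (1 / 2 : ℝ) ≤ (1 - (ε : ℝ)) ^ T := by
    -- Bernoulli: `(1 - ε) ^ T ≥ 1 - T ε = 1/2`.
    have hb := one_add_mul_le_pow (a := -(ε : ℝ)) (by change -2 ≤ -(1 / (2 * (T : ℝ))); linarith) T
    have he : (T : ℝ) * -(ε : ℝ) = -(1 / 2) := by
      change (T : ℝ) * -(1 / (2 * T)) = _
      field_simp
    rw [← sub_eq_add_neg 1 (ε : ℝ), he] at hb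
    linarith
  have h3 : ENNReal.ofReal (1 / 2) * ENNReal.ofReal (1 - 1 / 4) ≤
      π.law (hardScheme D ε) Eᶜ :=
    (mul_le_mul' (ENNReal.ofReal_le_ofReal hpow) h2).trans
      (π.ofReal_pow_mul_law_le (by linarith [ε.2.2]) (mul_profileProb_hardScheme_le ε) hE.compl)
  have h4 := add_le_add h1 h3
  rw [measure_add_measure_compl hE, Policy.law_univ, ← ENNReal.ofReal_mul (by norm_num),
    ← ENNReal.ofReal_add (by norm_num) (by norm_num), ENNReal.ofReal_le_one] at h4
  norm_num at h4

end InfoAcquisition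

/-- For some constant `δ > 0` no online algorithm guarantees, with probability at least `1 - δ`, that
all the mechanisms are IC and the regret is sublinear; neither for general sets of deviation functions,
nor when it only has to deal with ex-ante, or only with ex-interim, incentive compatibility. -/
theorem mainTheorem5 :
    ∃ δ : ℝ, 0 < δ ∧ ∀ alg : InfoAcquisition.OnlineAlgorithm.{u},
      ¬ alg.Guarantees δ Set.univ ∧
      ¬ alg.Guarantees δ {K | K.deviations = InfoAcquisition.GameForm.exAnte K.Signal} ∧
      ¬ alg.Guarantees δ {K | K.deviations = InfoAcquisition.GameForm.exInterim K.Signal} := by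
  refine ⟨1 / 4, by norm_num, fun alg => ⟨?_, ?_, ?_⟩⟩
  · exact InfoAcquisition.not_guarantees_of_hardForm_mem alg (Set.mem_univ _)
      (Set.mem_univ (InfoAcquisition.GameForm.hardForm Set.univ))
  · exact InfoAcquisition.not_guarantees_of_hardForm_mem alg
      (D := InfoAcquisition.GameForm.exAnte (Fin 2)) (fun _ _ => rfl) rfl
  · exact InfoAcquisition.not_guarantees_of_hardForm_mem alg
      (D := InfoAcquisition.GameForm.exInterim (Fin 2)) (Set.mem_univ _) rfl
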